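/- A triangulation of the torus is a finite (abstract) simplicial complex $K$ of dimension at most $2$ in which the link of every vertex is a cycle and whose geometric realization $|K|$ is homeomorphic to $S^1\times S^1$. It is even if every vertex has even degree (number of incident edges), and vertex-colorable if its vertices can be colored with three colors so that adjacent vertices have different colors. Let $C\subset|K|$ be a simple closed curve, that is, the image of a continuous injective map $S^1\to|K|$; it may cross triangles and need not run along edges. Cutting along $C$ divides every closed triangle $\tau$ of $K$ into pieces, the connected components of $\tau\setminus C$; a piece of $\tau$ and a piece of a triangle $\sigma$ are still glued to each other if they have a point in common. We say that $K$ becomes vertex-colorable after cutting along $C$ if one can choose, for every piece of every triangle $\tau$, a bijective coloring of the three vertices of $\tau$ by three colors, in such a way that pieces of $\tau$ and $\sigma$ that are glued to each other give the same color to every common vertex of $\tau$ and $\sigma$. (If $C$ runs along edges of $K$, this means that the triangulated surface obtained by cutting along $C$ is vertex-colorable.) Theorem. Every even triangulation $K$ of the torus is vertex-colorable, or there is a simple closed curve $C\subset|K|$ such that $K$ becomes vertex-colorable after cutting along $C$. -/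

import Mathlib

open scoped Finset

namespace AbstractSimplicialComplex

variable {V : Type*}

/-- The graph (1-skeleton) of a simplicial complex: distinct vertices are adjacent when they span an
edge. -/
def graph [DecidableEq V] (K : AbstractSimplicialComplex V) : SimpleGraph V where
  Adj u v := u ≠ v ∧ {u, v} ∈ K.faces
  symm := ⟨fun u v h => ⟨h.1.symm, by rw [Finset.pair_comm]; exact h.2⟩⟩
  loopless := ⟨fun _ h => h.1 rfl⟩

/-- The degree of a vertex: the number of edges containing it, that is, of its neighbours. -/
noncomputable def vertexDegree [DecidableEq V] (K : AbstractSimplicialComplex V) (v : V) : ℕ :=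
  (K.graph.neighborSet v).ncard

/-- A complex is even when all its vertices have even degree. -/
def IsEven [DecidableEq V] (K : AbstractSimplicialComplex V) : Prop :=
  ∀ v, Even (K.vertexDegree v)

/-- A complex is vertex-colorable when its vertices can be colored in three colors so that
neighbours have different colors. -/
def VertexColorable [DecidableEq V] (K : AbstractSimplicialComplex V) : Prop :=
  K.graph.Colorable 3

/-- The link of a vertex `v` of a 2-dimensional complex, as a graph on the neighbours of `v`: two of
them are joined when they span a triangle together with `v`. -/
def linkGraph [DecidableEq V] (K : AbstractSimplicialComplex V) (v : V) :
    SimpleGraph (K.graph.neighborSet v) where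
  Adj a b := a ≠ b ∧ {v, (a : V), (b : V)} ∈ K.faces
  symm := ⟨fun a b h => ⟨h.1.symm, by rw [Finset.pair_comm (b : V) (a : V)]; exact h.2⟩⟩
  loopless := ⟨fun _ h => h.1 rfl⟩

/-- A triangulated closed surface: a complex of dimension at most two in which the link of
every vertex is a cycle (a connected graph, regular of degree two). -/
structure IsTriangulatedClosedSurface [DecidableEq V] (K : AbstractSimplicialComplex V) : Prop where
  card_le_three : ∀ s ∈ K.faces, #s ≤ 3
  link_connected : ∀ v, (K.linkGraph v).Connected
  link_regular : ∀ v a, ((K.linkGraph v).neighborSet a).ncard = 2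

/-- The closed simplex spanned by the vertices in `s`, in barycentric coordinates. -/
def closedCell [Fintype V] (s : Finset V) : Set (V → ℝ) :=
  {x | x ∈ stdSimplex ℝ V ∧ ∀ v, v ∉ s → x v = 0}

/-- The geometric realization of a finite complex, a subspace of `V → ℝ`. -/
def realization [Fintype V] (K : AbstractSimplicialComplex V) : Set (V → ℝ) :=
  {x | ∃ s ∈ K.faces, x ∈ closedCell s}

/-- A triangulation of the torus: a triangulated closed surface whose realization is homeomorphic to
the product of two circles. -/
structure IsTorusTriangulation [Fintype V] [DecidableEq V] (K : AbstractSimplicialComplex V) :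
    Prop where
  surface : K.IsTriangulatedClosedSurface
  homeo_torus : Nonempty (K.realization ≃ₜ UnitAddCircle × UnitAddCircle)

/-- The triangulated surface becomes vertex-colorable after cutting along `C`.
Cutting along `C` divides a closed triangle `τ` into pieces, the connected components of the
complement of `C` in it; pieces of two triangles are still glued to each other at their common
points outside `C`. The color which the piece of `τ` through the point `x` gives to the vertex `v`
of `τ` is `φ τ x v`: every piece colors the three vertices of its triangle in three different
colors, and two pieces that are glued at a point give the same color to every vertex that their
triangles share. -/
def ColorableAfterCutting [Fintype V] (K : AbstractSimplicialComplex V) (C : Set (V → ℝ)) : Prop :=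
  ∃ φ : Finset V → (V → ℝ) → V → Fin 3,
    (∀ τ ∈ K.faces, #τ = 3 → ∀ x ∈ closedCell τ \ C, Set.InjOn (φ τ x) τ) ∧
    (∀ τ ∈ K.faces, #τ = 3 → ∀ S ⊆ closedCell τ \ C, IsPreconnected S →
      ∀ x ∈ S, ∀ y ∈ S, ∀ v ∈ τ, φ τ x v = φ τ y v) ∧
    (∀ τ ∈ K.faces, #τ = 3 → ∀ σ ∈ K.faces, #σ = 3 →
      ∀ x ∈ (closedCell τ ∩ closedCell σ) \ C, ∀ v ∈ τ, v ∈ σ → φ τ x v = φ σ x v)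

end AbstractSimplicialComplex

/-! Around a vertex of even degree the link is an even cycle, so the star can be colored with three
colors. Two star colorings differ by a permutation of the colors on their common triangles
(`exists_transition`), which gives a locally constant cocycle in $S_3$ on the cover of $|K|$ by open
stars. Pulled back to the plane, the universal cover of the torus, the cocycle becomes trivial
(`exists_trivialization_of_cocycle`), and the star colorings develop into a single one, which
lattice translations change by holonomy permutations. The holonomies of the two generators commute.
Commuting elements of $S_3$ are so restricted that one of the primitive vectors $(1,0)$, $(0,1)$,
$(1,1)$, $(1,-1)$ has trivial holonomy. A change of basis makes it $(1,0)$
(`IsDevelopment.exists_periodic`); the development then descends to the annulus left after removing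
a circle in that direction. This gives the second alternative in all cases. -/

open scoped Topology

/-! ### Cocycles and covering spaces -/

/-- A locally constant cocycle on an open cover becomes trivial after pullback to a simply connected
space. -/
theorem exists_trivialization_of_cocycle {X ι G A : Type*} [TopologicalSpace X] [Group G]
    [TopologicalSpace A] [SimplyConnectedSpace A] [LocallyPathConnectedSpace A]
    (U : ι → Set X) (hU : ∀ i, IsOpen (U i)) (cover : ∀ x, ∃ i, x ∈ U i) (g : ι → ι → G)
    (hg : ∀ i j k x, x ∈ U i → x ∈ U j → x ∈ U k → g i j * g j k = g i k) (F : C(A, X)) :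
    ∃ k : ι → A → G, (∀ i p, F p ∈ U i → ∀ᶠ q in 𝓝 p, k i q = k i p) ∧
      ∀ i j p, F p ∈ U i → F p ∈ U j → k j p = k i p * g i j := by
  let : TopologicalSpace G := ⊥
  have : DiscreteTopology G := ⟨rfl⟩
  choose ix hix using cover
  -- With discrete fiber $G$ the bundle is a covering, so `F` lifts to its total space; `k i` is the
  -- lift read in the chart `i`.
  let Z : FiberBundleCore ι X G :=
    { baseSet := U
      isOpen_baseSet := hU
      indexAt := ix
      mem_baseSet_at := hix
      coordChange := fun i j _ h => h * g i j
      coordChange_self := fun i x hx v => by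
        have := hg i i i x hx hx hx
        rw [mul_eq_right.mp this, mul_one]
      continuousOn_coordChange := fun i j =>
        ((continuous_of_discreteTopology (f := fun h : G => h * g i j)).comp
          continuous_snd).continuousOn
      coordChange_comp := fun i j k x hx v => by
        rw [mul_assoc, hg i j k x hx.1.1 hx.1.2 hx.2] }
  have cov : IsCoveringMap (Bundle.TotalSpace.proj : Bundle.TotalSpace G Z.Fiber → X) :=
    FiberBundle.isCoveringMap
  obtain ⟨a₀⟩ : Nonempty A := inferInstance
  obtain ⟨S, ⟨-, hS⟩, -⟩ := cov.existsUnique_continuousMap_lifts F a₀ ⟨F a₀, (1 : G)⟩ rfl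
  have hS' : ∀ p, (S p).proj = F p := fun p => congrFun hS p
  refine ⟨fun i p => ((Z.localTriv i) (S p)).2, fun i p hp => ?_, fun i j p hi hj => ?_⟩
  · have hsrc : S p ∈ (Z.localTriv i).source := by
      rw [Z.mem_localTriv_source, hS']; exact hp
    have h1 : ContinuousAt (fun q => ((Z.localTriv i) (S q)).2) p :=
      continuous_snd.continuousAt.comp
        (((Z.localTriv i).continuousAt hsrc).comp S.continuous.continuousAt)
    exact h1.eventually (show ∀ᶠ y in 𝓝 (((Z.localTriv i) (S p)).2), y = _ from
      (isOpen_discrete {((Z.localTriv i) (S p)).2}).mem_nhds rfl)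
  · let s : G := (S p).2
    change s * g (ix (S p).proj) j = s * g (ix (S p).proj) i * g i j
    have h0 : (S p).proj ∈ U (ix (S p).proj) := hix _
    have hi' : (S p).proj ∈ U i := by rw [hS']; exact hi
    have hj' : (S p).proj ∈ U j := by rw [hS']; exact hj
    rw [mul_assoc, hg _ _ _ _ h0 hi' hj']

/-! ### Even cycles and permutations of three colors -/

/-- A connected graph, regular of degree two, on an even number of vertices is bipartite. -/
theorem SimpleGraph.colorable_two_of_connected_of_ncard_neighborSet_eq_two {V : Type*} [Finite V]
    {G : SimpleGraph V} (hc : G.Connected) (h2 : ∀ v, (G.neighborSet v).ncard = 2)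
    (he : Even (Nat.card V)) : ∃ f : V → Bool, ∀ u v, G.Adj u v → f u ≠ f v := by
  classical
  have := Fintype.ofFinite V
  obtain ⟨v⟩ := hc.nonempty
  have hcyc : G.IsCycles := fun v _ => h2 v
  have hne : ∀ v, (G.neighborSet v).Nonempty := fun v =>
    Set.nonempty_of_ncard_ne_zero (by rw [h2]; norm_num)
  obtain ⟨p, hp, hpv⟩ := hcyc.exists_cycle_toSubgraph_verts_eq_connectedComponentSupp
    (c := G.connectedComponentMk v) rfl (hne v)
  have hall : ∀ u, u ∈ p.support := fun u => by
    rw [← SimpleGraph.Walk.mem_verts_toSubgraph, hpv]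
    exact SimpleGraph.ConnectedComponent.sound (hc.preconnected u v)
  -- Indices start at 1 because the base point of the cycle occurs at both 0 and `p.length`.
  have hex : ∀ u, ∃ i, (1 ≤ i ∧ i ≤ p.length) ∧ p.getVert i = u := fun u => by
    obtain ⟨i, hi, hil⟩ := SimpleGraph.Walk.mem_support_iff_exists_getVert.mp (hall u)
    rcases Nat.eq_zero_or_pos i with rfl | h
    · refine ⟨p.length, ⟨?_, le_rfl⟩, ?_⟩
      · have := hp.three_le_length; omega
      · rw [← hi]; simp
    · exact ⟨i, ⟨h, hil⟩, hi⟩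
  choose ix hix hixv using hex
  have hinj := hp.getVert_injOn
  have huniq : ∀ i, 1 ≤ i → i ≤ p.length → ix (p.getVert i) = i := fun i h1 h2 =>
    hinj (hix _) ⟨h1, h2⟩ (hixv _)
  have hlen : Even p.length := by
    have hb : Nat.card V = p.length := by
      have e : V ≃ Finset.Icc 1 p.length :=
        { toFun := fun u => ⟨ix u, Finset.mem_Icc.mpr (hix u)⟩
          invFun := fun i => p.getVert i
          left_inv := hixv
          right_inv := fun i => Subtype.ext
            (huniq i (Finset.mem_Icc.mp i.2).1 (Finset.mem_Icc.mp i.2).2) }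
      rw [Nat.card_congr e, Nat.card_eq_fintype_card, Fintype.card_coe, Nat.card_Icc,
        Nat.add_sub_cancel]
    rwa [← hb]
  have key : ∀ i, i < p.length →
      decide (Even (ix (p.getVert i))) ≠ decide (Even (ix (p.getVert (i + 1)))) := fun i hi => by
    rw [huniq (i + 1) (by omega) (by omega)]
    -- The closing edge joins index `p.length` to index 1; only here is the even length needed.
    rcases Nat.eq_zero_or_pos i with rfl | h
    · have : p.getVert 0 = p.getVert p.length := by simp
      rw [this, huniq _ (by omega) le_rfl]
      simp [hlen]
    · rw [huniq _ h (by omega)]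
      by_cases h : Even i <;> simp [h, Nat.even_add_one]
  refine ⟨fun u => decide (Even (ix u)), fun u w huw => ?_⟩
  have hadj := (hp.adj_toSubgraph_iff_of_isCycles hcyc
    ((SimpleGraph.Walk.mem_verts_toSubgraph p).mpr (hall u)) w).mpr huw
  obtain ⟨i, hi, hil⟩ := (SimpleGraph.Walk.toSubgraph_adj_iff p).mp hadj
  rcases Sym2.eq_iff.mp hi with ⟨rfl, rfl⟩ | ⟨rfl, rfl⟩
  · exact key i hil
  · exact (key i hil).symm

theorem Finset.exists_eq_insert_pair_of_card_eq_three {V : Type*} [DecidableEq V] {τ : Finset V}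
    {v : V} (h : #τ = 3) (hv : v ∈ τ) : ∃ a b, v ≠ a ∧ v ≠ b ∧ a ≠ b ∧ τ = {v, a, b} := by
  obtain ⟨a, b, hab, he⟩ := Finset.card_eq_two.mp
    (show #(τ.erase v) = 2 by rw [Finset.card_erase_of_mem hv, h])
  have ha : a ∈ τ.erase v := by rw [he]; simp
  have hb : b ∈ τ.erase v := by rw [he]; simp
  exact ⟨a, b, (Finset.ne_of_mem_erase ha).symm, (Finset.ne_of_mem_erase hb).symm, hab, by
    rw [← he, Finset.insert_erase hv]⟩

/-- A permutation of three elements may be prescribed at two of them. -/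
theorem Equiv.Perm.exists_fin_three_eq : ∀ a b a' b' : Fin 3, a ≠ b → a' ≠ b' →
    ∃ g : Equiv.Perm (Fin 3), g a = a' ∧ g b = b' ∧
      ∀ c c', c ≠ a → c ≠ b → c' ≠ a' → c' ≠ b' → g c = c' := by
  decide

/-! ### Star colorings and their transitions -/

namespace AbstractSimplicialComplex

variable {V : Type*} {K : AbstractSimplicialComplex V}

theorem mem_faces_of_subset {s t : Finset V} (ht : t ∈ K.faces) (h : s ⊆ t)
    (hs : s.Nonempty) : s ∈ K.faces :=
  (K.isRelLowerSet_faces ht).2 h hs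

theorem mem_of_mem_closedCell [Fintype V] {s : Finset V} {x : V → ℝ} (hx : x ∈ closedCell s) {v : V}
    (hv : x v ≠ 0) : v ∈ s :=
  not_not.mp fun h => hv (hx.2 v h)

theorem exists_ne_zero_of_mem_realization [Fintype V] {x : V → ℝ} (hx : x ∈ K.realization) :
    ∃ v, x v ≠ 0 := by
  obtain ⟨s, -, hxs⟩ := hx
  by_contra! h
  simpa [h] using hxs.1.2

theorem surjective_of_injOn_triangle {τ : Finset V} (h3 : #τ = 3) {c : V → Fin 3}
    (hc : Set.InjOn c τ) (i : Fin 3) : ∃ u ∈ τ, c u = i := by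
  have : τ.image c = Finset.univ :=
    Finset.eq_univ_of_card _ (by rw [Finset.card_image_of_injOn hc, h3, Fintype.card_fin])
  have hi := Finset.mem_univ i
  rw [← this] at hi
  simpa using hi

variable [DecidableEq V]

theorem graph_adj_of_mem_faces {s : Finset V} (hs : s ∈ K.faces) {a b : V} (ha : a ∈ s)
    (hb : b ∈ s) (hab : a ≠ b) : K.graph.Adj a b :=
  ⟨hab, mem_faces_of_subset hs (by simp [Finset.insert_subset_iff, ha, hb]) (by simp)⟩

theorem IsTriangulatedClosedSurface.exists_triangle_of_adj (hK : K.IsTriangulatedClosedSurface)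
    {v a : V} (h : K.graph.Adj v a) : ∃ τ ∈ K.faces, #τ = 3 ∧ v ∈ τ ∧ a ∈ τ := by
  obtain ⟨b, hb⟩ : ((K.linkGraph v).neighborSet ⟨a, h⟩).Nonempty :=
    Set.nonempty_of_ncard_ne_zero (by rw [hK.link_regular]; norm_num)
  have hab : a ≠ (b : V) := fun e => hb.1 (Subtype.ext e)
  have hvb : v ≠ (b : V) := b.2.1
  exact ⟨{v, a, (b : V)}, hb.2, Finset.card_eq_three.mpr ⟨v, a, b, h.1, hvb, hab, rfl⟩,
    by simp, by simp⟩

theorem IsTriangulatedClosedSurface.exists_triangle_superset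
    (hK : K.IsTriangulatedClosedSurface) {s : Finset V} (hs : s ∈ K.faces) :
    ∃ τ ∈ K.faces, #τ = 3 ∧ s ⊆ τ := by
  have h0 : s.Nonempty := (K.isRelLowerSet_faces hs).1
  have h3 := hK.card_le_three s hs
  have h1 := h0.card_pos
  obtain h | h | h : #s = 1 ∨ #s = 2 ∨ #s = 3 := by omega
  · obtain ⟨v, rfl⟩ := Finset.card_eq_one.mp h
    obtain ⟨a⟩ := (hK.link_connected v).nonempty
    obtain ⟨τ, h1, h2, h3, -⟩ := hK.exists_triangle_of_adj a.2
    exact ⟨τ, h1, h2, by simpa using h3⟩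
  · obtain ⟨v, a, hva, rfl⟩ := Finset.card_eq_two.mp h
    obtain ⟨τ, h1, h2, h3, h4⟩ := hK.exists_triangle_of_adj (v := v) (a := a) ⟨hva, hs⟩
    exact ⟨τ, h1, h2, by simp [Finset.insert_subset_iff, h3, h4]⟩
  · exact ⟨s, hs, h, subset_rfl⟩

/-- The star of a vertex of even degree of a triangulated closed surface can be colored in three
colors. -/
theorem IsTriangulatedClosedSurface.exists_star_coloring [Finite V]
    (hK : K.IsTriangulatedClosedSurface) {v : V} (hv : Even (K.vertexDegree v)) :
    ∃ c : V → Fin 3, ∀ τ ∈ K.faces, #τ = 3 → v ∈ τ → Set.InjOn c τ := by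
  classical
  obtain ⟨f, hf⟩ := SimpleGraph.colorable_two_of_connected_of_ncard_neighborSet_eq_two
    (hK.link_connected v) (hK.link_regular v)
    (by rwa [vertexDegree, ← Nat.card_coe_set_eq] at hv)
  let c : V → Fin 3 := fun u =>
    if h : u ∈ K.graph.neighborSet v then (if f ⟨u, h⟩ then 1 else 2) else 0
  refine ⟨c, fun τ hτ h3 hvτ => ?_⟩
  obtain ⟨a, b, hva, hvb, hab, rfl⟩ := Finset.exists_eq_insert_pair_of_card_eq_three h3 hvτ
  have ha : a ∈ K.graph.neighborSet v :=
    graph_adj_of_mem_faces hτ (by simp) (by simp) hva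
  have hb : b ∈ K.graph.neighborSet v :=
    graph_adj_of_mem_faces hτ (by simp) (by simp) hvb
  have hfab := hf ⟨a, ha⟩ ⟨b, hb⟩ ⟨fun e => hab (congrArg Subtype.val e), hτ⟩
  have cv : c v = 0 := by simp [c]
  have ca : c a = if f ⟨a, ha⟩ then 1 else 2 := by simp only [c, dif_pos ha]
  have cb : c b = if f ⟨b, hb⟩ then 1 else 2 := by simp only [c, dif_pos hb]
  have hca : c v ≠ c a := by rw [cv, ca]; split_ifs <;> decide
  have hcb : c v ≠ c b := by rw [cv, cb]; split_ifs <;> decide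
  have hcab : c a ≠ c b := by
    rw [ca, cb]
    revert hfab
    cases f ⟨a, ha⟩ <;> cases f ⟨b, hb⟩ <;> simp
  intro x hx y hy hxy
  simp only [Finset.coe_insert, Finset.coe_singleton, Set.mem_insert_iff,
    Set.mem_singleton_iff] at hx hy
  rcases hx with rfl | rfl | rfl <;> rcases hy with rfl | rfl | rfl <;>
    first | rfl | exact absurd hxy ‹_› | exact absurd hxy.symm ‹_›

/-- Colorings of the stars of two vertices differ by a permutation of the colors on the triangles
that contain both. -/
theorem exists_transition (c : V → V → Fin 3)
    (hc : ∀ v, ∀ τ ∈ K.faces, #τ = 3 → v ∈ τ → Set.InjOn (c v) τ) (v w : V) :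
    ∃ g : Equiv.Perm (Fin 3), ∀ τ ∈ K.faces, #τ = 3 → v ∈ τ → w ∈ τ →
      ∀ u ∈ τ, g (c w u) = c v u := by
  by_cases hvw : v = w
  · subst hvw
    exact ⟨1, fun _ _ _ _ _ _ _ => rfl⟩
  by_cases hex : ∃ τ ∈ K.faces, #τ = 3 ∧ v ∈ τ ∧ w ∈ τ
  · obtain ⟨σ, hσ, h3, hv, hw⟩ := hex
    -- The colors of `v` and `w` determine `g`, and the third color is then forced, so one `g`
    -- serves every triangle containing both.
    obtain ⟨g, hgv, hgw, hg⟩ := Equiv.Perm.exists_fin_three_eq (c w v) (c w w) (c v v) (c v w)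
      (fun h => hvw (hc w σ hσ h3 hw hv hw h)) (fun h => hvw (hc v σ hσ h3 hv hv hw h))
    refine ⟨g, fun τ hτ h3' hv' hw' u hu => ?_⟩
    by_cases huv : u = v
    · rw [huv, hgv]
    by_cases huw : u = w
    · rw [huw, hgw]
    have iw := hc w τ hτ h3' hw'
    have iv := hc v τ hτ h3' hv'
    exact hg _ _ (fun h => huv (iw hu hv' h)) (fun h => huw (iw hu hw' h))
      (fun h => huv (iv hu hv' h)) (fun h => huw (iv hu hw' h))
  · exact ⟨1, fun τ h1 h2 h3 h4 => (hex ⟨τ, h1, h2, h3, h4⟩).elim⟩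

variable [Fintype V]

theorem IsTriangulatedClosedSurface.exists_triangle_mem_closedCell
    (hK : K.IsTriangulatedClosedSurface) {x : V → ℝ} (hx : x ∈ K.realization) :
    ∃ τ ∈ K.faces, #τ = 3 ∧ x ∈ closedCell τ := by
  obtain ⟨s, hs, hxs⟩ := hx
  obtain ⟨τ, hτ, h3, hsτ⟩ := hK.exists_triangle_superset hs
  exact ⟨τ, hτ, h3, hxs.1, fun v hv => hxs.2 v fun h => hv (hsτ h)⟩

/-- The transition permutations between colorings of stars satisfy the cocycle condition. -/
theorem IsTriangulatedClosedSurface.transition_mul (hK : K.IsTriangulatedClosedSurface)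
    {c : V → V → Fin 3} (hc : ∀ v, ∀ τ ∈ K.faces, #τ = 3 → v ∈ τ → Set.InjOn (c v) τ)
    {g : V → V → Equiv.Perm (Fin 3)}
    (hg : ∀ v w, ∀ τ ∈ K.faces, #τ = 3 → v ∈ τ → w ∈ τ → ∀ u ∈ τ, g v w (c w u) = c v u)
    {x : V → ℝ} (hx : x ∈ K.realization) {v w y : V} (hv : x v ≠ 0) (hw : x w ≠ 0)
    (hy : x y ≠ 0) : g v w * g w y = g v y := by
  obtain ⟨τ, hτ, h3, hxτ⟩ := hK.exists_triangle_mem_closedCell hx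
  replace hv := mem_of_mem_closedCell hxτ hv
  replace hw := mem_of_mem_closedCell hxτ hw
  replace hy := mem_of_mem_closedCell hxτ hy
  ext i
  obtain ⟨u, hu, rfl⟩ := surjective_of_injOn_triangle h3 (hc y τ hτ h3 hy) i
  rw [Equiv.Perm.mul_apply, hg w y τ hτ h3 hw hy u hu, hg v w τ hτ h3 hv hw u hu,
    hg v y τ hτ h3 hv hy u hu]

end AbstractSimplicialComplex

/-! ### The torus and its universal cover -/

/-- The covering of the torus by the plane. -/
def torusCover (p : ℝ × ℝ) : UnitAddCircle × UnitAddCircle := (p.1, p.2)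

theorem continuous_torusCover : Continuous torusCover := by
  unfold torusCover
  exact ((AddCircle.continuous_mk' 1).comp continuous_fst).prodMk
    ((AddCircle.continuous_mk' 1).comp continuous_snd)

theorem torusCover_add_intCast (p : ℝ × ℝ) (m n : ℤ) :
    torusCover (p + ((m : ℝ), (n : ℝ))) = torusCover p := by
  have h : ∀ (x : ℝ) (m : ℤ), ((x + m : ℝ) : UnitAddCircle) = x := fun x m => by
    rw [AddCircle.coe_add, add_eq_left, AddCircle.coe_eq_zero_iff]
    exact ⟨m, by simp⟩
  simp [torusCover, h]

/-- The coordinates in `[a, a + 1) × [0, 1)` of a point of the torus. -/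
noncomputable def torusLift (a : ℝ) (z : UnitAddCircle × UnitAddCircle) : ℝ × ℝ :=
  (AddCircle.equivIco 1 a z.1, AddCircle.equivIco 1 0 z.2)

theorem torusCover_torusLift (a : ℝ) (z : UnitAddCircle × UnitAddCircle) :
    torusCover (torusLift a z) = z :=
  Prod.ext AddCircle.coe_equivIco AddCircle.coe_equivIco

theorem continuousAt_torusLift {a : ℝ} {z : UnitAddCircle × UnitAddCircle} (h1 : z.1 ≠ a)
    (h2 : z.2 ≠ 0) : ContinuousAt (torusLift a) z := by
  have e1 := AddCircle.continuousAt_equivIco (1 : ℝ) a h1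
  have e2 := AddCircle.continuousAt_equivIco (1 : ℝ) 0 (x := z.2) (by simpa using h2)
  exact (continuous_subtype_val.continuousAt.comp (e1.comp continuous_fst.continuousAt)).prodMk
    (continuous_subtype_val.continuousAt.comp (e2.comp continuous_snd.continuousAt))

/-! ### Developments and holonomy -/

namespace AbstractSimplicialComplex

variable {V : Type*} [Fintype V] {K : AbstractSimplicialComplex V}

/-- `k` trivializes over the plane the cocycle `g` on the cover of the realization by the open
stars of the vertices. -/
structure IsDevelopment (g : V → V → Equiv.Perm (Fin 3))
    (e : K.realization ≃ₜ UnitAddCircle × UnitAddCircle)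
    (k : V → ℝ × ℝ → Equiv.Perm (Fin 3)) : Prop where
  eventually_eq : ∀ v p, (e.symm (torusCover p)).1 v ≠ 0 → ∀ᶠ q in 𝓝 p, k v q = k v p
  eq_mul : ∀ v w p, (e.symm (torusCover p)).1 v ≠ 0 → (e.symm (torusCover p)).1 w ≠ 0 →
    k w p = k v p * g v w

theorem isOpen_openStar (v : V) : IsOpen {x : K.realization | x.1 v ≠ 0} :=
  isOpen_ne_fun ((continuous_apply v).comp continuous_subtype_val) continuous_const

variable {g : V → V → Equiv.Perm (Fin 3)} {e : K.realization ≃ₜ UnitAddCircle × UnitAddCircle}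
  {k : V → ℝ × ℝ → Equiv.Perm (Fin 3)}

/-- A development changes by a permutation of the colors, its holonomy, under an integer
translation. -/
theorem IsDevelopment.exists_holonomy (h : IsDevelopment g e k) (m n : ℤ) :
    ∃ ρ : Equiv.Perm (Fin 3), ∀ v p, (e.symm (torusCover p)).1 v ≠ 0 →
      k v (p + ((m : ℝ), (n : ℝ))) = ρ * k v p := by
  choose ix hix using fun x : K.realization => exists_ne_zero_of_mem_realization x.2
  let a : ℝ × ℝ := ((m : ℝ), (n : ℝ))
  have ha : ∀ p, torusCover (p + a) = torusCover p := fun p => torusCover_add_intCast p m n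
  let R : ℝ × ℝ → Equiv.Perm (Fin 3) := fun p =>
    k (ix (e.symm (torusCover p))) (p + a) * (k (ix (e.symm (torusCover p))) p)⁻¹
  -- The transition `g` cancels, so `R` does not depend on the chosen vertex.
  have hR : ∀ v p, (e.symm (torusCover p)).1 v ≠ 0 → R p = k v (p + a) * (k v p)⁻¹ := by
    intro v p hv
    have hi := hix (e.symm (torusCover p))
    simp only [R]
    rw [h.eq_mul v _ p hv hi, h.eq_mul v _ (p + a) (by rwa [ha]) (by rwa [ha])]
    group
  have hloc : IsLocallyConstant R := by
    rw [IsLocallyConstant.iff_eventually_eq]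
    intro p
    have hi := hix (e.symm (torusCover p))
    set v := ix (e.symm (torusCover p)) with hv
    have h1 := h.eventually_eq v p hi
    have h2 : ∀ᶠ q in 𝓝 p, k v (q + a) = k v (p + a) :=
      (continuous_add_const a).continuousAt.eventually
        (h.eventually_eq v (p + a) (by rwa [ha]))
    have h3 : ∀ᶠ q in 𝓝 p, (e.symm (torusCover q)).1 v ≠ 0 :=
      (e.symm.continuous.comp continuous_torusCover).continuousAt.eventually
        ((isOpen_openStar v).mem_nhds hi)
    filter_upwards [h1, h2, h3] with q h1 h2 h3
    rw [hR v q h3, hR v p hi, h1, h2]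
  refine ⟨R 0, fun v p hv => ?_⟩
  rw [hloc.apply_eq_of_preconnectedSpace 0 p, hR v p hv, inv_mul_cancel_right]

theorem IsDevelopment.comp (h : IsDevelopment g e k) {A : ℝ × ℝ → ℝ × ℝ} (hA : Continuous A)
    (B : UnitAddCircle × UnitAddCircle ≃ₜ UnitAddCircle × UnitAddCircle)
    (hAB : ∀ p, B (torusCover p) = torusCover (A p)) :
    IsDevelopment g (e.trans B.symm) fun v p => k v (A p) := by
  have hF : ∀ p, (e.trans B.symm).symm (torusCover p) = e.symm (torusCover (A p)) := fun p => by
    rw [← hAB]; rfl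
  refine ⟨fun v p hv => ?_, fun v w p hv hw => ?_⟩
  · rw [hF] at hv
    exact hA.continuousAt.eventually (h.eventually_eq v (A p) hv)
  · rw [hF] at hv hw
    exact h.eq_mul v w (A p) hv hw

/-- Nontrivial commuting elements of $S_3$ lie in a common cyclic subgroup of order 2 or 3, hence
are equal or inverse. -/
theorem commuting_perm_fin_three : ∀ a b : Equiv.Perm (Fin 3), a * b = b * a →
    a = 1 ∨ b = 1 ∨ a * b = 1 ∨ a = b := by
  decide

/-- The parametrization of the torus may be chosen so that the development is periodic in the first
coordinate: the holonomy is an abelian group of permutations of three colors, which is trivial on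
some primitive element of the lattice. -/
theorem IsDevelopment.exists_periodic (h : IsDevelopment g e k) :
    ∃ (e' : K.realization ≃ₜ UnitAddCircle × UnitAddCircle)
      (k' : V → ℝ × ℝ → Equiv.Perm (Fin 3)), IsDevelopment g e' k' ∧
      ∀ v s t, (e'.symm (torusCover (s, t))).1 v ≠ 0 → k' v (s + 1, t) = k' v (s, t) := by
  obtain ⟨ρ, hρ⟩ := h.exists_holonomy 1 0
  obtain ⟨μ, hμ⟩ := h.exists_holonomy 0 1
  have hcov : ∀ p (m n : ℤ), torusCover (p + ((m : ℝ), (n : ℝ))) = torusCover p :=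
    torusCover_add_intCast
  have hρ' : ∀ v s t, (e.symm (torusCover (s, t))).1 v ≠ 0 → k v (s + 1, t) = ρ * k v (s, t) :=
    fun v s t hv => by simpa using hρ v (s, t) hv
  have hμ' : ∀ v s t, (e.symm (torusCover (s, t))).1 v ≠ 0 → k v (s, t + 1) = μ * k v (s, t) :=
    fun v s t hv => by simpa using hμ v (s, t) hv
  have hc1 : ∀ s t, torusCover (s + 1, t) = torusCover (s, t) :=
    fun s t => by simpa using hcov (s, t) 1 0
  have hc2 : ∀ s t, torusCover (s, t + 1) = torusCover (s, t) :=
    fun s t => by simpa using hcov (s, t) 0 1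
  have hcomm : ρ * μ = μ * ρ := by
    obtain ⟨v, hv⟩ := exists_ne_zero_of_mem_realization (e.symm (torusCover (0, 0))).2
    have h1 : k v (0 + 1, 0 + 1) = ρ * (μ * k v (0, 0)) := by
      rw [hρ' v 0 (0 + 1) (by rwa [hc2]), hμ' v 0 0 hv]
    have h2 : k v (0 + 1, 0 + 1) = μ * (ρ * k v (0, 0)) := by
      rw [hμ' v (0 + 1) 0 (by rwa [hc1]), hρ' v 0 0 hv]
    rw [h1, ← mul_assoc, ← mul_assoc] at h2
    exact mul_right_cancel h2
  rcases commuting_perm_fin_three ρ μ hcomm with h1 | h1 | h1 | h1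
  · exact ⟨e, k, h, fun v s t hv => by rw [hρ' v s t hv, h1, one_mul]⟩
  · refine ⟨_, _, h.comp continuous_swap (Homeomorph.prodComm _ _) fun p => rfl,
      fun v s t hv => ?_⟩
    change (e.symm (torusCover (t, s))).1 v ≠ 0 at hv
    change k v (t, s + 1) = k v (t, s)
    rw [hμ' v t s hv, h1, one_mul]
  · refine ⟨_, _, h.comp (Homeomorph.shearAddRight ℝ).continuous
      (Homeomorph.shearAddRight UnitAddCircle) fun p => rfl, fun v s t hv => ?_⟩
    change (e.symm (torusCover (s, s + t))).1 v ≠ 0 at hv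
    change k v (s + 1, s + 1 + t) = k v (s, s + t)
    rw [add_right_comm, hρ' v s _ (by rwa [hc2]), hμ' v s _ hv, ← mul_assoc, h1, one_mul]
  · refine ⟨_, _, h.comp (Homeomorph.shearAddRight ℝ).symm.continuous
      (Homeomorph.shearAddRight UnitAddCircle).symm fun p => rfl, fun v s t hv => ?_⟩
    change (e.symm (torusCover (s, -s + t))).1 v ≠ 0 at hv
    change k v (s + 1, -(s + 1) + t) = k v (s, -s + t)
    obtain ⟨r, hr⟩ : ∃ r, r = -(s + 1) + t := ⟨_, rfl⟩
    have hr' : -s + t = r + 1 := by rw [hr]; ring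
    rw [hr', hc2] at hv
    rw [← hr, hr', hρ' v s r hv, hμ' v s r hv, h1]

/-- A development that is periodic in the first coordinate has the same values at points over the
same point of the torus and with the same second coordinate. -/
theorem periodic_eq_of_coe_eq
    (hper : ∀ v s t, (e.symm (torusCover (s, t))).1 v ≠ 0 → k v (s + 1, t) = k v (s, t))
    {v : V} {s s' t : ℝ} (hs : (s : UnitAddCircle) = s')
    (hv : (e.symm (torusCover (s, t))).1 v ≠ 0) : k v (s, t) = k v (s', t) := by
  classical
  have hc1 : ∀ s t, torusCover (s + 1, t) = torusCover (s, t) :=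
    fun s t => by simpa using torusCover_add_intCast (s, t) 1 0
  -- The value 1 outside the open star, where periodicity of `k v` is not assumed, makes the
  -- function periodic everywhere.
  have hP : Function.Periodic (fun s : ℝ =>
      if (e.symm (torusCover (s, t))).1 v ≠ 0 then k v (s, t) else 1) 1 := by
    intro s
    by_cases h : (e.symm (torusCover (s, t))).1 v = 0
    · simp [hc1, h]
    · simp [hc1, h, hper v s t h]
  have hv' : (e.symm (torusCover (s', t))).1 v ≠ 0 := by
    have : torusCover (s', t) = torusCover (s, t) := by simp [torusCover, hs]
    rwa [this]
  have h1 := hP.lift_coe s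
  rw [show ((s : ℝ) : AddCircle (1 : ℝ)) = s' from hs, hP.lift_coe s'] at h1
  simpa [hv, hv'] using h1.symm

/-! ### Coloring the complement of a circle -/

/-- The lift to $[0,1)^2$ jumps along two circles. Periodicity removes the jump in the first
coordinate: the seam can be moved to `s - 1 / 2`, half a turn from `x`. Only the circle $t=0$ has to
be cut. -/
theorem IsDevelopment.eventually_torusLift_eq (h : IsDevelopment g e k)
    (hper : ∀ v s t, (e.symm (torusCover (s, t))).1 v ≠ 0 → k v (s + 1, t) = k v (s, t))
    {v : V} {x : K.realization} (hv : x.1 v ≠ 0) (hx : (e x).2 ≠ 0) :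
    ∀ᶠ y in 𝓝 x, y.1 v ≠ 0 ∧ k v (torusLift 0 (e y)) = k v (torusLift 0 (e x)) := by
  set s : ℝ := (torusLift 0 (e x)).1 with hs
  have hs' : (s : UnitAddCircle) = (e x).1 := congrArg Prod.fst (torusCover_torusLift 0 (e x))
  have hne : (e x).1 ≠ ((s - 1 / 2 : ℝ) : UnitAddCircle) := by
    rw [← hs']
    intro he
    rw [AddCircle.coe_sub, eq_comm, sub_eq_self, AddCircle.coe_eq_zero_iff] at he
    obtain ⟨n, hn⟩ := he
    have h2 : ((2 * n : ℤ) : ℝ) = (1 : ℤ) := by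
      push_cast
      simp only [zsmul_eq_mul, mul_one] at hn
      rw [hn]; norm_num
    have := Int.cast_injective h2
    omega
  have hlift : ∀ y : K.realization, y.1 v ≠ 0 →
      k v (torusLift 0 (e y)) = k v (torusLift (s - 1 / 2) (e y)) := fun y hy => by
    refine periodic_eq_of_coe_eq hper (AddCircle.coe_equivIco.trans AddCircle.coe_equivIco.symm) ?_
    have : torusCover (↑(AddCircle.equivIco 1 0 (e y).1), ↑(AddCircle.equivIco 1 0 (e y).2)) = e y :=
      torusCover_torusLift 0 (e y)
    rwa [this, e.symm_apply_apply]
  have hcont : ContinuousAt (fun y => torusLift (s - 1 / 2) (e y)) x :=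
    ContinuousAt.comp (f := e) (continuousAt_torusLift hne hx) e.continuous.continuousAt
  have h1 := hcont.eventually (h.eventually_eq v _ (by
    rwa [torusCover_torusLift, e.symm_apply_apply]))
  filter_upwards [h1, (isOpen_openStar v).mem_nhds hv] with y h1 h2
  exact ⟨h2, by rw [hlift y h2, hlift x hv, h1]⟩

/-- If the development of the local colorings is periodic in the first coordinate, then the local
colorings fit together outside a circle of the torus in that direction. -/
theorem IsDevelopment.colorableAfterCutting (h : IsDevelopment g e k)
    (hper : ∀ v s t, (e.symm (torusCover (s, t))).1 v ≠ 0 → k v (s + 1, t) = k v (s, t))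
    {c : V → V → Fin 3} (hc : ∀ v, ∀ τ ∈ K.faces, #τ = 3 → v ∈ τ → Set.InjOn (c v) τ)
    (hg : ∀ v w, ∀ τ ∈ K.faces, #τ = 3 → v ∈ τ → w ∈ τ → ∀ u ∈ τ, g v w (c w u) = c v u) :
    K.ColorableAfterCutting
      (Set.range fun t : UnitAddCircle => (e.symm (t, 0) : V → ℝ)) := by
  classical
  choose ix hix using fun x : K.realization => exists_ne_zero_of_mem_realization x.2
  let κ : K.realization → V → Fin 3 := fun x u => k (ix x) (torusLift 0 (e x)) (c (ix x) u)
  -- Any vertex whose open star contains `x` gives the same color.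
  have hκ : ∀ (x : K.realization) v, x.1 v ≠ 0 → ∀ τ ∈ K.faces, #τ = 3 → x.1 ∈ closedCell τ →
      ∀ u ∈ τ, κ x u = k v (torusLift 0 (e x)) (c v u) := by
    intro x v hv τ hτ h3 hxτ u hu
    have hF : e.symm (torusCover (torusLift 0 (e x))) = x := by
      rw [torusCover_torusLift, e.symm_apply_apply]
    simp only [κ]
    rw [h.eq_mul v (ix x) _ (by rwa [hF]) (by rw [hF]; exact hix x), Equiv.Perm.mul_apply,
      hg v (ix x) τ hτ h3 (mem_of_mem_closedCell hxτ hv) (mem_of_mem_closedCell hxτ (hix x)) u hu]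
  let φ : (V → ℝ) → V → Fin 3 := fun x u => if hx : x ∈ K.realization then κ ⟨x, hx⟩ u else 0
  have hφ : ∀ (x : K.realization) u, φ x u = κ x u := fun x u => by simp only [φ, dif_pos x.2]
  -- The color depends on the point alone, not on the triangle, so the gluing condition is
  -- immediate.
  refine ⟨fun _ => φ, fun τ hτ h3 x hx => ?_, fun τ hτ h3 S hS hSc x hx y hy v hv => ?_,
    fun _ _ _ _ _ _ _ _ _ _ _ => rfl⟩
  · have hxK : x ∈ K.realization := ⟨τ, hτ, hx.1⟩
    intro u hu w hw huw
    have huw' : κ ⟨x, hxK⟩ u = κ ⟨x, hxK⟩ w := by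
      rw [← hφ, ← hφ]; exact huw
    exact hc _ τ hτ h3 (mem_of_mem_closedCell hx.1 (hix ⟨x, hxK⟩)) hu hw
      ((k _ _).injective huw')
  · refine hSc.constant (f := fun x => φ x v) (fun z hz => ?_) hx hy
    have hSK : S ⊆ K.realization := fun w hw => ⟨τ, hτ, (hS hw).1⟩
    let z' : K.realization := ⟨z, hSK hz⟩
    have hez : (e z').2 ≠ 0 := fun h0 => (hS hz).2 ⟨(e z').1, by
      have : ((e z').1, (0 : UnitAddCircle)) = e z' := Prod.ext rfl h0.symm
      simp only [this, e.symm_apply_apply, z']⟩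
    have hev : ∀ᶠ y : K.realization in 𝓝 z', y.1 ∈ closedCell τ → φ y v = φ z v := by
      filter_upwards [h.eventually_torusLift_eq hper (hix z') hez] with y hy hyτ
      rw [hφ y, hφ z', hκ y _ hy.1 τ hτ h3 hyτ v hv, hy.2]
    have hev' := (eventually_nhds_subtype_iff _ _
      (fun y => y ∈ closedCell τ → φ y v = φ z v)).mp hev
    refine tendsto_nhds_of_eventually_eq ?_
    filter_upwards [nhdsWithin_mono z hSK hev', self_mem_nhdsWithin] with y hy hyS
    exact hy (hS hyS).1

/-- An even triangulation of the torus becomes vertex-colorable after cutting along some simple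
closed curve. -/
theorem IsTorusTriangulation.exists_colorableAfterCutting [DecidableEq V]
    (hK : K.IsTorusTriangulation) (heven : K.IsEven) :
    ∃ γ : UnitAddCircle → K.realization, Continuous γ ∧ Function.Injective γ ∧
      K.ColorableAfterCutting (Set.range fun t => (γ t : V → ℝ)) := by
  obtain ⟨e⟩ := hK.homeo_torus
  choose c hc using fun v => hK.surface.exists_star_coloring (heven v)
  choose g hg using exists_transition c hc
  obtain ⟨k, hk1, hk2⟩ := exists_trivialization_of_cocycle
    (fun v => {x : K.realization | x.1 v ≠ 0}) isOpen_openStar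
    (fun x => exists_ne_zero_of_mem_realization x.2) g
    (fun v w y x hv hw hy => hK.surface.transition_mul hc hg x.2 hv hw hy)
    ⟨fun p => e.symm (torusCover p), e.symm.continuous.comp continuous_torusCover⟩
  obtain ⟨e', k', h, hper⟩ := IsDevelopment.exists_periodic (e := e) ⟨hk1, hk2⟩
  exact ⟨fun t => e'.symm (t, 0), e'.symm.continuous.comp (by fun_prop),
    fun s t hst => congrArg Prod.fst (e'.symm.injective hst),
    h.colorableAfterCutting hper hc hg⟩

end AbstractSimplicialComplex

theorem mainTheorem8 {V : Type*} [Fintype V] [DecidableEq V] (K : AbstractSimplicialComplex V)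
    (hK : K.IsTorusTriangulation) (heven : K.IsEven) :
    K.VertexColorable ∨
      ∃ γ : UnitAddCircle → K.realization, Continuous γ ∧ Function.Injective γ ∧
        K.ColorableAfterCutting (Set.range fun t => (γ t : V → ℝ)) :=
  Or.inr (hK.exists_colorableAfterCutting heven)
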